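/- Let $\mathcal A$ be a commutative unital C*-algebra and let $\mathcal M$ be a full (left) Hilbert $\mathcal A$-module, i.e. $\mathcal M$ is a Hilbert C*-module over $\mathcal A$ and the closed linear span of $\{\langle x,y\rangle : x,y\in\mathcal M\}$ is $\mathcal A$. Let $\mathrm{End}^*_{\mathcal A}(\mathcal M)$ be the algebra, under composition, of all adjointable operators on $\mathcal M$, that is, of all bounded $\mathcal A$-linear maps $T:\mathcal M\to\mathcal M$ for which there is a map $T^*:\mathcal M\to\mathcal M$ with $\langle Tx,y\rangle=\langle x,T^*y\rangle$ for all $x,y\in\mathcal M$. Then every 2-local derivation on $\mathrm{End}^*_{\mathcal A}(\mathcal M)$ is a derivation. Here a derivation on a complex algebra $\mathcal B$ is a linear map $d:\mathcal B\to\mathcal B$ with $d(ab)=d(a)b+a\,d(b)$ for all $a,b\in\mathcal B$, and a 2-local derivation on $\mathcal B$ is a map $\delta:\mathcal B\to\mathcal B$ (not assumed linear or continuous) such that for all $a,b\in\mathcal B$ there is a derivation $d_{a,b}:\mathcal B\to\mathcal B$ with $\delta(a)=d_{a,b}(a)$ and $\delta(b)=d_{a,b}(b)$. -/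

import Mathlib

/-- A Hilbert `A`-module `E` is *full* if the closed linear span of all the inner products of
elements of `E` is the whole algebra `A`.

Here and below a (left) Hilbert `A`-module is modelled by Mathlib's `CStarModule A E`, whose inner
product is linear in the second variable: `inner A x (a • y) = a * inner A x y`. A left Hilbert
module with an inner product `⟨·,·⟩` that is linear in the first variable is one of these, with
`inner A x y = ⟨y, x⟩`. -/
def IsFullHilbertModule (A E : Type*) [CommCStarAlgebra A] [PartialOrder A]
    [NormedAddCommGroup E] [NormedSpace ℂ E] [Module A E] [CStarModule A E] : Prop :=
  closure (Submodule.span ℂ {a : A | ∃ x y : E, a = inner A x y} : Set A) = Set.univ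

/-- Complex scalars commute with the action of `A` on a Hilbert `A`-module. -/
theorem complex_smul_algebra_smul {A E : Type*} [CommCStarAlgebra A] [PartialOrder A]
    [NormedAddCommGroup E] [NormedSpace ℂ E] [Module A E] [CStarModule A E]
    (c : ℂ) (a : A) (x : E) : c • a • x = a • c • x := by
  have h : ∀ y : E, inner A y (c • a • x - a • c • x) = 0 := by
    intro y
    simp
  exact sub_eq_zero.mp (CStarModule.inner_self.mp (h _))

/-- The algebra `End*_A(E)` of all adjointable operators on a Hilbert `A`-module `E`: the bounded
`A`-linear maps `T : E → E` for which there is a map `S : E → E` with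
`⟪T x, y⟫ = ⟪x, S y⟫` for all `x`, `y`. The product is composition. -/
def adjointableEnd (A E : Type*) [CommCStarAlgebra A] [PartialOrder A]
    [NormedAddCommGroup E] [NormedSpace ℂ E] [Module A E] [CStarModule A E] :
    Subalgebra ℂ (E →L[ℂ] E) where
  carrier := {T | (∀ (a : A) (x : E), T (a • x) = a • T x) ∧
    ∃ S : E → E, ∀ x y : E, inner A (T x) y = inner A x (S y)}
  mul_mem' := by
    rintro T T' ⟨hT, S, hS⟩ ⟨hT', S', hS'⟩
    refine ⟨fun a x => by simp [hT, hT'], fun y => S' (S y), fun x y => ?_⟩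
    simp [hS, hS']
  add_mem' := by
    rintro T T' ⟨hT, S, hS⟩ ⟨hT', S', hS'⟩
    refine ⟨fun a x => by simp [hT, hT'], fun y => S y + S' y, fun x y => ?_⟩
    simp [hS, hS']
  algebraMap_mem' := by
    intro c
    refine ⟨fun a x => ?_, fun y => star c • y, fun x y => ?_⟩
    · simp [Algebra.algebraMap_eq_smul_one, complex_smul_algebra_smul]
    · simp [Algebra.algebraMap_eq_smul_one]

/-- A map `d : B → B` on a complex algebra `B` is a *derivation* if it is linear and
`d (x y) = d(x) y + x d(y)` for all `x`, `y`. -/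
structure IsDerivation {B : Type*} [Ring B] [Algebra ℂ B] (d : B → B) : Prop where
  isLinearMap : IsLinearMap ℂ d
  map_mul : ∀ x y : B, d (x * y) = d x * y + x * d y

/-- A map `δ : B → B` (not assumed linear or continuous) on a complex algebra `B` is a *2-local
derivation* if for any two elements `a`, `b` some derivation agrees with `δ` at both. -/
def IsTwoLocalDerivation {B : Type*} [Ring B] [Algebra ℂ B] (δ : B → B) : Prop :=
  ∀ a b : B, ∃ d : B → B, IsDerivation d ∧ δ a = d a ∧ δ b = d b

open CStarModule WeakDual

/-! ### Derivations of a commutative C*-algebra. -/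

section Commutative

variable {A : Type*} [CommCStarAlgebra A]

/-! Since `A` has no nonzero derivations, a derivation of the operator algebra kills the scalars
from `A`, so it is `A`-linear. If it also kills θ = `rankOne u v`, applying it to θxθ = ⟪v, xu⟫θ
shows that its coefficients at `(u, v)` vanish. Hence the coefficient of δ at `(u, v)` is, for all
operators at once, that of one derivation, and δ is linear and `A`-linear.

The derivation depends on `(u, v)`, so the product rule needs more: `A`-linear maps preserving
vanishing at vectors are left multiplications, and dually those preserving left annihilators are
right multiplications. The first handles Q ↦ pδ(aQ) when pa = 0; the second then handles a ↦ δ(ay) -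
δ(a)y. -/

theorem eq_zero_of_forall_character {a : A} (h : ∀ χ : characterSpace ℂ A, χ a = 0) : a = 0 := by
  refine (gelfandTransform_isometry A).injective ?_
  ext χ
  simpa using h χ

instance CommCStarAlgebra.isReduced : IsReduced A where
  eq_zero a := fun ⟨n, h⟩ => eq_zero_of_forall_character fun χ => by
    have := congrArg χ h
    rw [map_pow, map_zero] at this
    exact eq_zero_of_pow_eq_zero this

variable [PartialOrder A] [StarOrderedRing A]

/-- With a = b², also χ(b) = 0, and χ(Da) = 2χ(b)χ(Db). -/
theorem character_derivation_eq_zero_of_nonneg (D : Derivation ℂ A A) (χ : characterSpace ℂ A)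
    {a : A} (ha : 0 ≤ a) (h : χ a = 0) : χ (D a) = 0 := by
  rw [← CFC.sqrt_mul_sqrt_self a ha] at h ⊢
  rw [map_mul, mul_self_eq_zero] at h
  simp [h]

theorem character_derivation_eq_zero_of_isSelfAdjoint (D : Derivation ℂ A A)
    (χ : characterSpace ℂ A) {a : A} (ha : IsSelfAdjoint a) (h : χ a = 0) : χ (D a) = 0 := by
  have hsub := CFC.posPart_sub_negPart a ha
  have hmul := congrArg χ (CFC.posPart_mul_negPart a)
  have heq : χ a⁺ = χ a⁻ := by
    rw [← sub_eq_zero, ← map_sub, hsub, h]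
  rw [map_mul, map_zero, heq, mul_self_eq_zero] at hmul
  rw [← hsub, map_sub, map_sub,
    character_derivation_eq_zero_of_nonneg D χ (CFC.posPart_nonneg a) (heq.trans hmul),
    character_derivation_eq_zero_of_nonneg D χ (CFC.negPart_nonneg a) hmul, sub_zero]

/-- A commutative C*-algebra has no nonzero derivations. -/
theorem derivation_apply_eq_zero (D : Derivation ℂ A A) (a : A) : D a = 0 := by
  have key : ∀ b : A, IsSelfAdjoint b → D b = 0 := by
    intro b hb
    refine eq_zero_of_forall_character fun χ => ?_
    have him : star (χ b) = χ b := by rw [← map_star, hb.star_eq]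
    have h0 : χ (b - algebraMap ℂ A (χ b)) = 0 := by
      rw [map_sub, AlgHomClass.commutes, Algebra.algebraMap_self, RingHom.id_apply, sub_self]
    have hsa : IsSelfAdjoint (b - algebraMap ℂ A (χ b)) :=
      hb.sub (by rw [isSelfAdjoint_iff, ← algebraMap_star_comm, him])
    simpa using character_derivation_eq_zero_of_isSelfAdjoint D χ hsa h0
  rw [← realPart_add_I_smul_imaginaryPart a, map_add, D.map_smul, key _ (realPart a).2,
    key _ (imaginaryPart a).2, smul_zero, add_zero]

end Commutative

/-! ### Operators on a Hilbert module and their derivations. -/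

section Module

variable {A E : Type*} [CommCStarAlgebra A] [PartialOrder A]
  [NormedAddCommGroup E] [NormedSpace ℂ E] [Module A E] [CStarModule A E]

theorem eq_of_forall_inner_right_eq {x y : E} (h : ∀ z : E, inner A z x = inner A z y) :
    x = y := by
  rw [← sub_eq_zero, ← CStarModule.inner_self (A := A), CStarModule.inner_sub_right, h, sub_self]

theorem eq_zero_of_forall_inner_smul_eq_zero {x : E} (h : ∀ z : E, inner A z x • x = 0) :
    x = 0 := by
  rw [← CStarModule.inner_self (A := A)]
  refine eq_zero_of_pow_eq_zero (n := 2) ?_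
  rw [sq, ← inner_op_smul_right, h, CStarModule.inner_zero_right]

theorem smul_eq_zero_of_sq_smul_eq_zero {a : A} {x : E} (h : a ^ 2 • x = 0) : a • x = 0 := by
  refine eq_of_forall_inner_right_eq (A := A) fun z => ?_
  rw [CStarModule.inner_zero_right]
  refine eq_zero_of_pow_eq_zero (n := 2) ?_
  calc inner A z (a • x) ^ 2 = inner A z (a ^ 2 • x) * inner A z x := by simp; ring
    _ = 0 := by rw [h, CStarModule.inner_zero_right, zero_mul]

theorem norm_algebra_smul_le (a : A) (x : E) : ‖a • x‖ ≤ ‖a‖ * ‖x‖ := by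
  refine (sq_le_sq₀ (norm_nonneg _) (by positivity)).mp ?_
  rw [norm_sq_eq A, mul_pow, norm_sq_eq A (x := x)]
  calc ‖inner A (a • x) (a • x)‖ = ‖a * (inner A x x * star a)‖ := by simp
    _ ≤ ‖a‖ * (‖inner A x x‖ * ‖star a‖) :=
      (norm_mul_le _ _).trans (by gcongr; exact norm_mul_le _ _)
    _ = ‖a‖ ^ 2 * ‖inner A x x‖ := by rw [norm_star]; ring

theorem IsDerivation.sub {d d' : adjointableEnd A E → adjointableEnd A E} (hd : IsDerivation d)
    (hd' : IsDerivation d') : IsDerivation fun x => d x - d' x where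
  isLinearMap := hd.isLinearMap.mk' _ - hd'.isLinearMap.mk' _ |>.isLinear
  map_mul x y := by rw [hd.map_mul, hd'.map_mul, sub_mul, mul_sub]; abel

namespace adjointableEnd

theorem map_algebra_smul (T : adjointableEnd A E) (a : A) (x : E) :
    T.1 (a • x) = a • T.1 x := T.2.1 a x

@[ext]
theorem ext {S T : adjointableEnd A E} (h : ∀ x, S.1 x = T.1 x) : S = T :=
  Subtype.ext (ContinuousLinearMap.ext h)

theorem eq_of_forall_inner {S T : adjointableEnd A E}
    (h : ∀ u v : E, inner A v (S.1 u) = inner A v (T.1 u)) : S = T :=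
  ext fun u => eq_of_forall_inner_right_eq (A := A) fun v => h u v

variable (E) in
/-- Multiplication by an element of `A`, as an adjointable operator. -/
noncomputable def scalar (a : A) : adjointableEnd A E :=
  ⟨LinearMap.mkContinuous
    { toFun := fun x => a • x
      map_add' := smul_add a
      map_smul' := fun c x => (complex_smul_algebra_smul c a x).symm } ‖a‖
    (norm_algebra_smul_le a), fun b x => smul_comm a b x, fun x => star a • x,
    fun x y => by simp [mul_comm]⟩

@[simp]
theorem scalar_apply (a : A) (x : E) : (scalar E a).1 x = a • x := rfl

theorem scalar_mul_comm (a : A) (T : adjointableEnd A E) :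
    scalar E a * T = T * scalar E a := by
  ext x
  simp [map_algebra_smul]

variable [StarOrderedRing A]

/-- The adjoint of an adjointable operator is itself an adjointable operator. -/
theorem exists_adjoint (T : adjointableEnd A E) :
    ∃ S : adjointableEnd A E, ∀ x y : E, inner A (T.1 x) y = inner A x (S.1 y) := by
  obtain ⟨S, hS⟩ := T.2.2
  have hS' : ∀ x y : E, inner A (S x) y = inner A x (T.1 y) := fun x y => by
    rw [← star_inner, ← hS, star_inner]
  refine ⟨⟨LinearMap.mkContinuous
    { toFun := S
      map_add' := fun x y => eq_of_forall_inner_right_eq (A := A) fun z => by simp [← hS]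
      map_smul' := fun c x => eq_of_forall_inner_right_eq (A := A) fun z => by simp [← hS] }
    ‖T.1‖ fun x => ?_, ?_, T.1, hS'⟩, hS⟩
  · change ‖S x‖ ≤ ‖T.1‖ * ‖x‖
    rcases (norm_nonneg (S x)).eq_or_lt' with h | h
    · rw [h]; positivity
    · refine le_of_mul_le_mul_right ?_ h
      calc ‖S x‖ * ‖S x‖ = ‖inner A (T.1 (S x)) x‖ := by rw [← sq, norm_sq_eq A, hS]
        _ ≤ ‖T.1 (S x)‖ * ‖x‖ := norm_inner_le E
        _ ≤ ‖T.1‖ * ‖S x‖ * ‖x‖ := by gcongr; exact T.1.le_opNorm _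
        _ = ‖T.1‖ * ‖x‖ * ‖S x‖ := by ring
  · intro a x
    change S (a • x) = a • S x
    exact eq_of_forall_inner_right_eq (A := A) fun z => by simp [← hS]

/-- The adjoint of an adjointable operator. -/
noncomputable def adj (T : adjointableEnd A E) : adjointableEnd A E := (exists_adjoint T).choose

theorem inner_apply_left (T : adjointableEnd A E) (x y : E) :
    inner A (T.1 x) y = inner A x ((adj T).1 y) := (exists_adjoint T).choose_spec x y

theorem inner_apply_right (T : adjointableEnd A E) (x y : E) :
    inner A x (T.1 y) = inner A ((adj T).1 x) y := by
  rw [← star_inner, inner_apply_left, star_inner]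

theorem adj_eq {S T : adjointableEnd A E}
    (h : ∀ x y : E, inner A (T.1 x) y = inner A x (S.1 y)) : adj T = S := by
  ext y
  exact eq_of_forall_inner_right_eq (A := A) fun x => by rw [← inner_apply_left, h]

theorem adj_adj (T : adjointableEnd A E) : adj (adj T) = T :=
  adj_eq fun x y => (inner_apply_right T x y).symm

theorem adj_add (S T : adjointableEnd A E) : adj (S + T) = adj S + adj T :=
  adj_eq fun x y => by simp [inner_apply_left]

theorem adj_mul (S T : adjointableEnd A E) : adj (S * T) = adj T * adj S :=
  adj_eq fun x y => by simp [inner_apply_left]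

theorem adj_one : adj (1 : adjointableEnd A E) = 1 :=
  adj_eq fun x y => by simp

theorem adj_scalar (a : A) : adj (scalar E a) = scalar E (star a) :=
  adj_eq fun x y => by simp [mul_comm]

/-- The elementary operator `z ↦ ⟪v, z⟫ u`. -/
noncomputable def rankOne (u v : E) : adjointableEnd A E :=
  ⟨LinearMap.mkContinuous
    { toFun := fun z => inner A v z • u
      map_add' := fun x y => by simp [add_smul]
      map_smul' := fun c x => eq_of_forall_inner_right_eq (A := A) fun z => by simp }
    (‖v‖ * ‖u‖) (fun x => by
      change ‖inner A v x • u‖ ≤ _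
      calc ‖inner A v x • u‖ ≤ ‖inner A v x‖ * ‖u‖ := norm_algebra_smul_le _ _
        _ ≤ ‖v‖ * ‖x‖ * ‖u‖ := by gcongr; exact norm_inner_le E
        _ = ‖v‖ * ‖u‖ * ‖x‖ := by ring),
    fun a x => by simp [mul_smul], fun z => inner A u z • v,
    fun x y => by simp [mul_comm]⟩

@[simp]
theorem rankOne_apply (u v z : E) : (rankOne (A := A) u v).1 z = inner A v z • u := rfl

end adjointableEnd

variable [StarOrderedRing A]

open adjointableEnd

namespace IsDerivation

variable {d : adjointableEnd A E → adjointableEnd A E}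

theorem map_scalar (hd : IsDerivation d) (a : A) : d (scalar E a) = 0 := by
  ext x
  refine eq_of_forall_inner_right_eq (A := A) fun y => ?_
  let D : Derivation ℂ A A := Derivation.mk'
    { toFun := fun b => inner A y ((d (scalar E b)).1 x)
      map_add' := fun b c => by
        have : scalar E (b + c) = scalar E b + scalar E c := by ext z; simp [add_smul]
        rw [this, hd.isLinearMap.map_add]
        simp
      map_smul' := fun c b => by
        have : scalar E (c • b) = c • scalar E b := by
          ext z
          exact eq_of_forall_inner_right_eq (A := A) fun w => by simp
        rw [this, hd.isLinearMap.map_smul]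
        simp }
    (fun b c => by
      have : scalar E (b * c) = scalar E b * scalar E c := by ext z; simp [mul_smul]
      simp [this, hd.map_mul, map_algebra_smul, add_comm])
  exact (derivation_apply_eq_zero D a).trans CStarModule.inner_zero_right.symm

theorem map_scalar_mul (hd : IsDerivation d) (a : A) (T : adjointableEnd A E) :
    d (scalar E a * T) = scalar E a * d T := by
  rw [hd.map_mul, hd.map_scalar, zero_mul, zero_add]

/-- Differentiating θxθ = ⟪v, xu⟫θ gives sθ = 0 with s = ⟪v, d(x)u⟫. Suitable vectors turn this into
s³ = 0, and `A` is reduced. -/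
theorem inner_apply_eq_zero (hd : IsDerivation d) {u v : E} (h : d (rankOne u v) = 0)
    (x : adjointableEnd A E) : inner A v ((d x).1 u) = 0 := by
  have h₁ : rankOne u v * x * rankOne u v = scalar E (inner A v (x.1 u)) * rankOne u v := by
    ext z
    simp [map_algebra_smul, smul_smul]
  have h₂ := congrArg d h₁
  rw [hd.map_scalar_mul, hd.map_mul, hd.map_mul, h, zero_mul, mul_zero, zero_add, add_zero,
    mul_zero] at h₂
  set s := inner A v ((d x).1 u) with hs
  have h₃ : ∀ z w : E, inner A v z * (s * inner A w u) = 0 := fun z w => by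
    have := congrArg (fun T : adjointableEnd A E => inner A w (T.1 z)) h₂
    simpa [map_algebra_smul, hs] using this
  refine eq_zero_of_pow_eq_zero (n := 3) ?_
  have h₄ := h₃ ((d x).1 u) ((adj (d x)).1 v)
  rw [← inner_apply_right, ← hs] at h₄
  linear_combination h₄

end IsDerivation

/-- The matrix coefficient of a 2-local derivation at a pair of vectors is that of a derivation. -/
theorem IsTwoLocalDerivation.exists_inner_apply_eq {δ : adjointableEnd A E → adjointableEnd A E}
    (hδ : IsTwoLocalDerivation δ) (u v : E) :
    ∃ d : adjointableEnd A E → adjointableEnd A E, IsDerivation d ∧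
      ∀ x, inner A v ((δ x).1 u) = inner A v ((d x).1 u) := by
  obtain ⟨d, hd, h, -⟩ := hδ (rankOne u v) (rankOne u v)
  refine ⟨d, hd, fun x => ?_⟩
  obtain ⟨d', hd', h₁, h₂⟩ := hδ (rankOne u v) x
  have := (hd'.sub hd).inner_apply_eq_zero (u := u) (v := v) (by simp [← h, ← h₁]) x
  rw [h₂, ← sub_eq_zero, ← this]
  simp

namespace adjointableEnd

/-- An `A`-linear map on operators that preserves the vanishing at each vector is a left
multiplication. -/
theorem eq_apply_one_mul_of_apply_eq_zero {H : adjointableEnd A E → adjointableEnd A E}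
    (hsub : ∀ S T, H (S - T) = H S - H T)
    (hsmul : ∀ (a : A) T, H (scalar E a * T) = scalar E a * H T)
    (hH : ∀ (T : adjointableEnd A E) (u : E), T.1 u = 0 → (H T).1 u = 0)
    (Q : adjointableEnd A E) : H Q = H 1 * Q := by
  ext u
  rw [← sub_eq_zero]
  set z := Q.1 u with hz
  set s := (H Q).1 u - (H 1 * Q).1 u with hs
  have hs' : s = (H Q).1 u - (H 1).1 z := rfl
  -- ⟪v, w⟫T and `rankOne (T w) v` agree at w, hence so do their images under `H`.
  have hrank : ∀ (T : adjointableEnd A E) (v w : E),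
      inner A v w • (H T).1 w = (H (rankOne (T.1 w) v)).1 w := fun T v w => by
    have h := hH (scalar E (inner A v w) * T - rankOne (T.1 w) v) w (by simp)
    rw [hsub, hsmul] at h
    simpa [sub_eq_zero] using h
  have hdiag : ∀ v : E, (inner A v z * inner A v u) • s = 0 := fun v => by
    have h₁ := hrank Q v u
    have h₂ := hrank 1 v z
    have h₃ := hH (rankOne z v) (inner A v z • u - inner A v u • z) (by simp [mul_comm])
    simp only [map_sub, map_algebra_smul, sub_eq_zero] at h₃
    rw [← hz] at h₁
    have h₂' : (rankOne ((1 : adjointableEnd A E).1 z) v) = rankOne (A := A) z v := rfl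
    rw [h₂'] at h₂
    rw [hs', smul_sub, sub_eq_zero, mul_smul, h₁, h₃, ← h₂, smul_smul, mul_comm]
  have hpol : ∀ v w : E, (inner A v z * inner A w u) • s = 0 := fun v w => by
    refine smul_eq_zero_of_sq_smul_eq_zero ?_
    have h := hdiag (v + w)
    have hv := hdiag v
    have hw := hdiag w
    have h₁ : (inner A v z * inner A w u + inner A w z * inner A v u) • s = 0 := by
      have : (inner A v z * inner A w u + inner A w z * inner A v u) • s =
          (inner A (v + w) z * inner A (v + w) u) • s - (inner A v z * inner A v u) • s
            - (inner A w z * inner A w u) • s := by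
        rw [← sub_smul, ← sub_smul]
        congr 1
        simp only [CStarModule.inner_add_left]
        ring
      rw [this, h, hv, hw, sub_zero, sub_zero]
    -- The product of the two cross terms is also a product of diagonal ones, which kill s.
    have : (inner A v z * inner A w u) ^ 2 • s =
        (inner A v z * inner A w u) •
          (inner A v z * inner A w u + inner A w z * inner A v u) • s
        - (inner A w z * inner A w u) • (inner A v z * inner A v u) • s := by
      rw [smul_smul, smul_smul, ← sub_smul]
      congr 1
      ring
    rw [this, h₁, hv, smul_zero, smul_zero, sub_zero]
  have hz₀ : ∀ v y : E, inner A v z * inner A y s = 0 := fun v y => by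
    have hG : s = (H Q - H 1 * Q).1 u := by simp [hs]
    -- This choice of w makes ⟪w, u⟫ equal to ⟪y, s⟫.
    have h := congrArg (inner A y) (hpol v ((adj (H Q - H 1 * Q)).1 y))
    rw [← inner_apply_right, ← hG, inner_op_smul_right, CStarModule.inner_zero_right] at h
    refine eq_zero_of_pow_eq_zero (n := 2) ?_
    linear_combination inner A v z * h
  refine eq_zero_of_forall_inner_smul_eq_zero (A := A) fun y => ?_
  -- ⟪y, s⟫Q vanishes at u, so ⟪y, s⟫ kills both terms of s.
  have hσz : inner A y s • z = 0 := eq_of_forall_inner_right_eq (A := A) fun v => by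
    rw [inner_op_smul_right, CStarModule.inner_zero_right, mul_comm, hz₀]
  have hσH := hH (scalar E (inner A y s) * Q) u hσz
  rw [hsmul] at hσH
  have hσH' : inner A y s • (H Q).1 u = 0 := hσH
  nth_rw 2 [hs']
  rw [smul_sub, hσH', ← map_algebra_smul, hσz, map_zero, sub_zero]

/-- An `A`-linear map on operators that preserves left annihilators is a right multiplication. -/
theorem eq_mul_apply_one_of_mul_eq_zero {K : adjointableEnd A E → adjointableEnd A E}
    (hsub : ∀ S T, K (S - T) = K S - K T)
    (hsmul : ∀ (a : A) T, K (scalar E a * T) = scalar E a * K T)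
    (hK : ∀ P T : adjointableEnd A E, P * T = 0 → P * K T = 0)
    (T : adjointableEnd A E) : K T = T * K 1 := by
  have adj_sub : ∀ S T : adjointableEnd A E, adj (S - T) = adj S - adj T := fun S T => by
    rw [eq_sub_iff_add_eq, ← adj_add, sub_add_cancel]
  have h := eq_apply_one_mul_of_apply_eq_zero (H := fun T => adj (K (adj T)))
    (fun S T => by rw [adj_sub, hsub, adj_sub])
    (fun a T => by
      rw [adj_mul, adj_scalar, ← scalar_mul_comm, hsmul, adj_mul, adj_scalar, star_star,
        scalar_mul_comm])
    (fun T u hu => by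
      set y := (adj (K (adj T))).1 u with hy
      -- Tu = 0 becomes a left annihilator of T*; evaluating the preserved relation at y gives ⟪y,
      -- y⟫² = 0.
      have hP : rankOne y u * adj T = 0 := by
        ext z
        simp [inner_apply_right, adj_adj, hu]
      have h := congrArg (fun S : adjointableEnd A E => inner A y (S.1 y)) (hK _ _ hP)
      have h₁ : inner A y y * inner A y y = 0 := by
        simpa [inner_apply_right, ← hy] using h
      exact CStarModule.inner_self.mp ((sq (inner A y y)).trans h₁ |> eq_zero_of_pow_eq_zero)) (adj T)
  simp only [adj_adj, adj_one] at h
  rw [← adj_adj (K T), h, adj_mul, adj_adj, adj_adj]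

end adjointableEnd

end Module

/-! Neither the fullness nor the completeness of the module is needed in the proof. -/

open adjointableEnd

theorem mainTheorem3 {A E : Type*} [CommCStarAlgebra A] [PartialOrder A] [StarOrderedRing A]
    [NormedAddCommGroup E] [NormedSpace ℂ E] [CompleteSpace E] [Module A E] [CStarModule A E]
    (hfull : IsFullHilbertModule A E)
    (δ : adjointableEnd A E → adjointableEnd A E) (hδ : IsTwoLocalDerivation δ) :
    IsDerivation δ := by
  have hadd : ∀ x y, δ (x + y) = δ x + δ y := fun x y => eq_of_forall_inner fun u v => by
    obtain ⟨d, hd, h⟩ := hδ.exists_inner_apply_eq u v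
    rw [h, hd.isLinearMap.map_add]
    simp [h]
  have hsub : ∀ x y, δ (x - y) = δ x - δ y := fun x y => by
    rw [eq_sub_iff_add_eq, ← hadd, sub_add_cancel]
  have hsmul : ∀ (a : A) x, δ (scalar E a * x) = scalar E a * δ x :=
    fun a x => eq_of_forall_inner fun u v => by
      obtain ⟨d, hd, h⟩ := hδ.exists_inner_apply_eq u v
      rw [h, hd.map_scalar_mul]
      simp [h]
  have hone : δ 1 = 0 := by
    obtain ⟨d, hd, h, -⟩ := hδ 1 1
    have := hd.map_mul 1 1
    rw [mul_one, mul_one, one_mul, left_eq_add] at this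
    rw [h, this]
  have hleft : ∀ p a Q : adjointableEnd A E, p * a = 0 → p * δ (a * Q) = p * δ a * Q := by
    intro p a Q hpa
    have := eq_apply_one_mul_of_apply_eq_zero (H := fun Q => p * δ (a * Q))
      (fun S T => by rw [mul_sub, hsub, mul_sub])
      (fun b T => by
        rw [← mul_assoc, ← scalar_mul_comm, mul_assoc, hsmul, ← mul_assoc, ← scalar_mul_comm,
          mul_assoc])
      (fun T u hu => eq_of_forall_inner_right_eq (A := A) fun v => by
        obtain ⟨d, hd, h⟩ := hδ.exists_inner_apply_eq u ((adj p).1 v)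
        -- As pa = 0, the Leibniz term containing d(T) disappears, so vanishing of T at u is
        -- preserved.
        have h₁ : p * d (a * T) = p * d a * T := by
          rw [hd.map_mul, mul_add, ← mul_assoc, ← mul_assoc p a, hpa, zero_mul, add_zero]
        calc inner A v ((p * δ (a * T)).1 u) = inner A v ((p * d (a * T)).1 u) := by
              simpa [inner_apply_right] using h (a * T)
          _ = inner A v 0 := by rw [h₁]; simp [hu]) Q
    simpa using this
  have hmul : ∀ x y, δ (x * y) - δ x * y = x * δ y := fun x y => by
    have := eq_mul_apply_one_of_mul_eq_zero (K := fun a => δ (a * y) - δ a * y)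
      (fun S T => by rw [sub_mul, hsub, hsub, sub_mul]; abel)
      (fun b T => by rw [mul_assoc, hsmul, hsmul, mul_assoc, mul_sub])
      (fun p a hpa => by rw [mul_sub, hleft p a y hpa, mul_assoc, sub_self]) x
    simpa [hone] using this
  refine ⟨⟨hadd, fun c x => eq_of_forall_inner fun u v => ?_⟩, fun x y => ?_⟩
  · obtain ⟨d, hd, h⟩ := hδ.exists_inner_apply_eq u v
    rw [h, hd.isLinearMap.map_smul]
    simp [h]
  · rw [← hmul, add_sub_cancel]
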